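/- Let $n\in\mathbb{N}$ and identify the space $\mathcal S^n$ of real symmetric $n\times n$ matrices with $\mathbb{R}^{N}$, $N=n(n+1)/2$, through $\mathrm{vec}(X)=(X_{ij})_{i\le j}$ (the entries on and above the main diagonal), with the inner product $\langle X,Y\rangle=\mathrm{Tr}(XY)$. Let $\mathcal S^n_+\subset\mathbb{R}^{N}$ be the cone of positive semidefinite matrices in these coordinates and $(\mathcal S^n_+)^*$ its dual cone with respect to $\langle\cdot,\cdot\rangle$. Let $A\in\mathbb{R}^{N\times N}$ be Hurwitz (all its complex eigenvalues have negative real part), cross-positive over $\mathcal S^n_+$ (that is, $\langle y,Ax\rangle\ge 0$ whenever $x\in\mathcal S^n_+$, $y\in(\mathcal S^n_+)^*$ and $\langle y,x\rangle=0$), and $\mathcal S^n_+$-irreducible (no eigenvector of $A$ lies on the boundary of $\mathcal S^n_+$). Let $\Lambda$ be the set of standard basis vectors of $\mathbb{R}^{N}$ that lie in $\mathcal S^n_+$, and let $\Pi$ be the set of those that lie in $(\mathcal S^n_+)^*$. Then $$\Pi=\Lambda=\{\mathrm{vec}(\mathrm{diag}(e_i)) : i=1,\dots,n\},$$ and for every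 $b\in\Lambda$ and every $c\in\Pi$ such that the system $\dot x=Ax+bu$, $y=c^\top x$ is cone-invariant over $\mathcal S^n_+$ (that is, $x(t)\in\mathcal S^n_+$ and $y(t)\ge0$ for all $t\ge0$ whenever $x(0)\in\mathcal S^n_+$ and $u(t)\ge 0$ for all $t\ge 0$, for continuous inputs $u$), the sensor $c$ is a successful defense against attacks entering through $b$: for each $s_0\ge 0$, either $$\mathrm{rank}\begin{bmatrix}s_0I-A&b\\c^\top&0\end{bmatrix}=N+1,$$ or this rank is less than $N+1$ and $d_0=0$ for every $d_0\in\mathbb{R}$ such that the attack $d(t)=-e^{s_0t}d_0$ is undetectable. Here an attack $d$ is undetectable if for some initial state the solution of $\dot x=Ax+bd$ satisfies $c^\top x(t)=0$ for all $t\ge 0$. -/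

import Mathlib

open scoped Matrix

namespace ConeDefense

section LTI

variable {ι : Type*} [Fintype ι] [DecidableEq ι]

/-- Hurwitz stability: every complex eigenvalue of `A` has negative real part. -/
def IsHurwitz (A : Matrix ι ι ℝ) : Prop :=
  ∀ μ ∈ spectrum ℂ (A.map (algebraMap ℝ ℂ)), μ.re < 0

/-- `x` is a state trajectory on `[0, ∞)` of `x'(t) = A x(t) + b u(t)`. -/
def IsTrajectory (A : Matrix ι ι ℝ) (b : ι → ℝ) (u : ℝ → ℝ) (x : ℝ → ι → ℝ) : Prop :=
  ∀ t : ℝ, 0 ≤ t → HasDerivWithinAt x (A *ᵥ x t + u t • b) (Set.Ici 0) t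

/-- The system `x' = A x + b u`, `y = cᵀ x` is cone-invariant over `K`: whenever `x(0) ∈ K` and
`u ≥ 0` on `[0, ∞)`, the state stays in `K` and the output stays nonnegative. -/
def IsConeInvariantSystem (K : Set (ι → ℝ)) (A : Matrix ι ι ℝ) (b c : ι → ℝ) : Prop :=
  ∀ (u : ℝ → ℝ) (x : ℝ → ι → ℝ), ContinuousOn u (Set.Ici 0) → (∀ t : ℝ, 0 ≤ t → 0 ≤ u t) →
    IsTrajectory A b u x → x 0 ∈ K → ∀ t : ℝ, 0 ≤ t → x t ∈ K ∧ 0 ≤ c ⬝ᵥ x t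

/-- The attack signal `d`, entering the system through `b`, is undetectable from the output
`y = cᵀ x`: for some initial state (the difference of the actual initial state and
the attack initial condition) the output is identically zero. -/
def IsUndetectableAttack (A : Matrix ι ι ℝ) (b c : ι → ℝ) (d : ℝ → ℝ) : Prop :=
  ∃ x : ℝ → ι → ℝ, IsTrajectory A b d x ∧ ∀ t : ℝ, 0 ≤ t → c ⬝ᵥ x t = 0

/-- The zero-dynamics attack signal `d(t) = -e^{s₀ t} d₀`. -/
noncomputable def zeroDynamicsAttack (s₀ d₀ : ℝ) : ℝ → ℝ :=
  fun t => -(Real.exp (s₀ * t) * d₀)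

/-- The Rosenbrock system matrix `[s₀ I - A, b; cᵀ, 0]`. -/
def rosenbrock (A : Matrix ι ι ℝ) (b c : ι → ℝ) (s₀ : ℝ) : Matrix (ι ⊕ Unit) (ι ⊕ Unit) ℝ :=
  Matrix.fromBlocks (s₀ • (1 : Matrix ι ι ℝ) - A) (Matrix.replicateCol Unit b)
    (Matrix.replicateRow Unit c) 0

/-- The sensor `c` is a successful defense against attacks entering through `b`: for each
`s₀ ≥ 0`, either the Rosenbrock matrix has full rank, or it is rank deficient and every undetectable
attack `-e^{s₀ t} d₀` has `d₀ = 0`. -/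
def IsSuccessfulDefense (A : Matrix ι ι ℝ) (b c : ι → ℝ) : Prop :=
  ∀ s₀ : ℝ, 0 ≤ s₀ →
    (rosenbrock A b c s₀).rank = Fintype.card ι + 1 ∨
    ((rosenbrock A b c s₀).rank < Fintype.card ι + 1 ∧
      ∀ d₀ : ℝ, IsUndetectableAttack A b c (zeroDynamicsAttack s₀ d₀) → d₀ = 0)

/-- The dual cone of `K` with respect to the pairing `ip`. -/
def dualCone (ip : (ι → ℝ) → (ι → ℝ) → ℝ) (K : Set (ι → ℝ)) : Set (ι → ℝ) :=
  {y | ∀ x ∈ K, 0 ≤ ip x y}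

/-- `A` is cross-positive over `K`. -/
def IsCrossPositive (ip : (ι → ℝ) → (ι → ℝ) → ℝ) (K : Set (ι → ℝ)) (A : Matrix ι ι ℝ) : Prop :=
  ∀ x ∈ K, ∀ y ∈ dualCone ip K, ip y x = 0 → 0 ≤ ip y (A *ᵥ x)

/-- `K`-irreducibility: no eigenvector of `A` lies on the boundary of `K`. -/
def IsConeIrreducible (K : Set (ι → ℝ)) (A : Matrix ι ι ℝ) : Prop :=
  ∀ (μ : ℝ) (x : ι → ℝ), Module.End.HasEigenvector (Matrix.toLin' A) μ x → x ∉ frontier K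

/-- The standard basis vectors that lie in `S`. -/
def basisIn (S : Set (ι → ℝ)) : Set (ι → ℝ) :=
  {v | v ∈ S ∧ ∃ i : ι, v = Pi.single i 1}

end LTI

section PSD

/-- Positions on and above the main diagonal of an `n × n` matrix. -/
abbrev UpperIdx (n : ℕ) : Type := {p : Fin n × Fin n // p.1 ≤ p.2}

/-- Half-vectorization: the list of the entries on and above the main diagonal. -/
def halfVec {n : ℕ} (X : Matrix (Fin n) (Fin n) ℝ) : UpperIdx n → ℝ :=
  fun p => X p.1.1 p.1.2

/-- The symmetric matrix with prescribed entries on and above the main diagonal. -/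
def symMat {n : ℕ} (x : UpperIdx n → ℝ) : Matrix (Fin n) (Fin n) ℝ :=
  Matrix.of fun i j => x ⟨(min i j, max i j), min_le_max⟩

theorem halfVec_symMat {n : ℕ} (x : UpperIdx n → ℝ) : halfVec (symMat x) = x := by
  funext p
  obtain ⟨⟨i, j⟩, h⟩ := p
  have h' : i ≤ j := h
  simp [halfVec, symMat, h']

theorem symMat_halfVec {n : ℕ} (X : Matrix (Fin n) (Fin n) ℝ) (hX : X.IsSymm) :
    symMat (halfVec X) = X := by
  ext i j
  rcases le_total i j with h | h
  · simp [halfVec, symMat, h]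
  · simpa [halfVec, symMat, h] using hX.apply i j

/-- The cone of positive semidefinite `n × n` matrices, in vectorized coordinates. -/
def psdCone (n : ℕ) : Set (UpperIdx n → ℝ) :=
  {x | (symMat x).PosSemidef}

/-- The inner product `⟨X, Y⟩ = Tr (X Y)`, in vectorized coordinates. -/
def traceInner {n : ℕ} (x y : UpperIdx n → ℝ) : ℝ :=
  (symMat x * symMat y).trace

/-- The vectorization of `diag (e_i)`. -/
def vecDiag {n : ℕ} (i : Fin n) : UpperIdx n → ℝ :=
  halfVec (Matrix.diagonal (Pi.single i (1 : ℝ)))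

/-- `Λ`: the positions accessible to an attacker. -/
def attackSet (n : ℕ) : Set (UpperIdx n → ℝ) :=
  basisIn (psdCone n)

/-- `Π`: the sensor positions, that is the basis vectors in the dual cone. -/
def sensorSet (n : ℕ) : Set (UpperIdx n → ℝ) :=
  basisIn (dualCone traceInner (psdCone n))

end PSD

end ConeDefense

/-! The rank is full for every `s ≥ 0`. Put `B = A - s`, which is again Hurwitz; eliminating the
state from the Rosenbrock matrix, it is invertible once `c ⬝ᵥ z ≠ 0` for the solution `z` of `B z =
-b` (`rank_rosenbrock_eq`). As `c` is a diagonal unit, `c ⬝ᵥ z` is a diagonal entry of `z`.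

Morally `z = ∫₀^∞ exp(tB) b dt`. Cone invariance with zero input makes `exp(tB)` preserve the cone,
so `z` is positive semidefinite and `exp(tB) z ≤ z`. If some `z i i` vanished, the face `F`
generated by `z` would consist of boundary points. Every `x ∈ F` satisfies `x ≤ α z`, hence `exp(tB)
x ≤ α z`: the flow, and with it `(-B)⁻¹`, preserves `F`. Krein-Rutman on `F`
(`exists_eigenvector_of_positive`) then yields an eigenvector of `B`, hence of `A`, on the boundary,
against irreducibility (`quadForm_resolvent_ne_zero`). -/

namespace ConeDefense

/-! ### Matrix exponentials and decay of Hurwitz flows -/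

section Flow

variable {ι : Type*} [Fintype ι] [DecidableEq ι]

open scoped Matrix.Norms.Operator in
theorem hasDerivAt_exp_mulVec (B : Matrix ι ι ℝ) (x : ι → ℝ) (t : ℝ) :
    HasDerivAt (fun t : ℝ => NormedSpace.exp (t • B) *ᵥ x)
      (NormedSpace.exp (t • B) *ᵥ (B *ᵥ x)) t := by
  have h := hasDerivAt_exp_smul_const (𝕂 := ℝ) B t
  let ev : Matrix ι ι ℝ →L[ℝ] (ι → ℝ) :=
    LinearMap.toContinuousLinearMap ((Matrix.mulVecBilin ℝ ℝ).flip x)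
  have := ev.hasFDerivAt.comp_hasDerivAt t h
  rw [Matrix.mulVec_mulVec]
  exact this

theorem exp_mulVec_comm (B : Matrix ι ι ℝ) (x : ι → ℝ) (t : ℝ) :
    NormedSpace.exp (t • B) *ᵥ (B *ᵥ x) = B *ᵥ (NormedSpace.exp (t • B) *ᵥ x) := by
  have h : Commute (NormedSpace.exp (t • B)) B := by
    open scoped Matrix.Norms.Operator in
    exact ((Commute.refl B).smul_left t).exp_left
  rw [Matrix.mulVec_mulVec, Matrix.mulVec_mulVec, h.eq]

open scoped Matrix.Norms.Operator in
theorem exp_smul_mulVec_of_pow_eq_zero (N : Matrix ι ι ℂ) (v : ι → ℂ) (k : ℕ)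
    (h : N ^ k *ᵥ v = 0) (t : ℂ) :
    NormedSpace.exp (t • N) *ᵥ v =
      ∑ j ∈ Finset.range k, (((j.factorial : ℂ)⁻¹) * t ^ j) • (N ^ j *ᵥ v) := by
  have hs := NormedSpace.exp_series_hasSum_exp' (𝕂 := ℂ) (t • N)
  let ev : Matrix ι ι ℂ →L[ℂ] (ι → ℂ) :=
    LinearMap.toContinuousLinearMap ((Matrix.mulVecBilin ℂ ℂ).flip v)
  have hs' := ev.hasSum hs
  have hev : ∀ X, ev X = X *ᵥ v := fun X => rfl
  refine hs'.unique ?_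
  have hf : ∀ j, ev (((j.factorial : ℂ)⁻¹) • (t • N) ^ j) =
      (((j.factorial : ℂ)⁻¹) * t ^ j) • (N ^ j *ᵥ v) := by
    intro j
    rw [hev, smul_pow, smul_smul, Matrix.smul_mulVec]
  simp_rw [hf]
  refine hasSum_sum_of_ne_finset_zero fun j hj => ?_
  have hkj : k ≤ j := by simpa using hj
  obtain ⟨i, rfl⟩ := Nat.exists_eq_add_of_le' hkj
  rw [pow_add N, ← Matrix.mulVec_mulVec, h, Matrix.mulVec_zero, smul_zero]

theorem tendsto_exp_mul_pow_of_re_neg {μ : ℂ} (hμ : μ.re < 0) (j : ℕ) :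
    Filter.Tendsto (fun t : ℝ => Complex.exp ((t : ℂ) * μ) * (t : ℂ) ^ j) Filter.atTop
      (nhds 0) := by
  rw [tendsto_zero_iff_norm_tendsto_zero]
  have h := (Real.tendsto_pow_mul_exp_neg_atTop_nhds_zero j).comp
    (Filter.tendsto_id.const_mul_atTop (neg_pos.mpr hμ))
  have h2 := h.const_mul (((-μ.re) ^ j)⁻¹)
  rw [mul_zero] at h2
  refine h2.congr' ?_
  filter_upwards [Filter.eventually_ge_atTop 0] with t ht
  have hne : (-μ.re) ^ j ≠ 0 := pow_ne_zero _ (neg_pos.mpr hμ).ne'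
  simp only [Function.comp_apply, id, norm_mul, Complex.norm_exp, norm_pow, Complex.norm_real,
    Real.norm_of_nonneg ht, mul_pow]
  have he : ((t : ℂ) * μ).re = -(-μ.re * t) := by simp; ring
  rw [he]
  field_simp

-- The generalized eigenspaces span; on the one for `μ`, the flow is `exp(tμ)` times a polynomial in
-- `t`, because `M - μ` acts nilpotently.
open scoped Matrix.Norms.Operator in
theorem tendsto_exp_mulVec_complex (M : Matrix ι ι ℂ) (hM : ∀ μ ∈ spectrum ℂ M, μ.re < 0)
    (v : ι → ℂ) :
    Filter.Tendsto (fun t : ℝ => NormedSpace.exp ((t : ℂ) • M) *ᵥ v) Filter.atTop (nhds 0) := by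
  have hv : v ∈ ⨆ μ : ℂ, Module.End.maxGenEigenspace (Matrix.toLin' M) μ := by
    rw [Module.End.iSup_maxGenEigenspace_eq_top]; trivial
  refine Submodule.iSup_induction _ (motive := fun v =>
    Filter.Tendsto (fun t : ℝ => NormedSpace.exp ((t : ℂ) • M) *ᵥ v) Filter.atTop (nhds 0))
    hv ?_ ?_ ?_
  · intro μ w hw
    rcases eq_or_ne w 0 with rfl | hw0
    · simp
    have hμ : μ.re < 0 := by
      refine hM μ ?_
      rw [← Matrix.spectrum_toLin' M, ← Module.End.hasEigenvalue_iff_mem_spectrum]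
      by_contra hne
      apply hw0
      -- If `μ` is not an eigenvalue, `M - μ` and all its powers are injective, which forces the
      -- generalized eigenvector `w` to be zero.
      have hinj : Function.Injective (Matrix.toLin' M - μ • (1 : Module.End ℂ (ι → ℂ))) := by
        rw [← LinearMap.ker_eq_bot]
        have := Module.End.hasEigenvalue_iff.not.mp hne
        rw [not_not, Module.End.eigenspace_def] at this
        exact this
      obtain ⟨k, hk⟩ := (Module.End.mem_maxGenEigenspace _ _ _).mp hw
      rw [Module.End.pow_apply] at hk
      refine hinj.iterate k ?_
      rw [hk, ← Module.End.pow_apply, map_zero]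
    obtain ⟨k, hk⟩ := (Module.End.mem_maxGenEigenspace _ _ _).mp hw
    set N : Matrix ι ι ℂ := M - μ • 1 with hN
    have hk' : N ^ k *ᵥ w = 0 := by
      rw [← hk, ← Matrix.toLin'_apply, Matrix.toLin'_pow]
      simp [hN, map_sub, Module.End.one_eq_id]
    have hexp : ∀ t : ℝ, NormedSpace.exp ((t : ℂ) • M) *ᵥ w =
        ∑ j ∈ Finset.range k, (Complex.exp ((t : ℂ) * μ) * (t : ℂ) ^ j) •
          (((j.factorial : ℂ)⁻¹) • (N ^ j *ᵥ w)) := by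
      intro t
      have hsplit : (t : ℂ) • M = ((t : ℂ) * μ) • (1 : Matrix ι ι ℂ) + (t : ℂ) • N := by
        rw [hN, smul_sub, smul_smul]; abel
      have hcomm : Commute (((t : ℂ) * μ) • (1 : Matrix ι ι ℂ)) ((t : ℂ) • N) :=
        ((Commute.one_left N).smul_left _).smul_right _
      have hone : NormedSpace.exp (((t : ℂ) * μ) • (1 : Matrix ι ι ℂ)) =
          Complex.exp ((t : ℂ) * μ) • (1 : Matrix ι ι ℂ) := by
        rw [← Algebra.algebraMap_eq_smul_one, ← Algebra.algebraMap_eq_smul_one,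
          Complex.exp_eq_exp_ℂ]
        exact (NormedSpace.algebraMap_exp_comm _).symm
      rw [hsplit, Matrix.exp_add_of_commute _ _ hcomm, hone, smul_mul_assoc, one_mul,
        Matrix.smul_mulVec, exp_smul_mulVec_of_pow_eq_zero N w k hk', Finset.smul_sum]
      refine Finset.sum_congr rfl fun j _ => ?_
      rw [smul_smul, smul_smul]
      ring_nf
    simp_rw [hexp]
    rw [← Finset.sum_const_zero (s := Finset.range k)]
    refine tendsto_finsetSum _ fun j _ => ?_
    simpa using (tendsto_exp_mul_pow_of_re_neg hμ j).smul_const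
      (((j.factorial : ℂ)⁻¹) • (N ^ j *ᵥ w))
  · simp
  · intro x y hx hy
    simpa [Matrix.mulVec_add] using hx.add hy

open scoped Matrix.Norms.Operator in
theorem IsHurwitz.tendsto_exp_mulVec {B : Matrix ι ι ℝ} (hB : IsHurwitz B) (x : ι → ℝ) :
    Filter.Tendsto (fun t : ℝ => NormedSpace.exp (t • B) *ᵥ x) Filter.atTop (nhds 0) := by
  have h := tendsto_exp_mulVec_complex _ hB (fun i => (x i : ℂ))
  rw [tendsto_pi_nhds] at h ⊢
  intro i
  have hi := (Complex.continuous_re.tendsto _).comp (h i)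
  refine hi.congr fun t => ?_
  let f : Matrix ι ι ℝ →+* Matrix ι ι ℂ := (algebraMap ℝ ℂ).mapMatrix
  have hf : Continuous f := by
    refine continuous_matrix fun i j => ?_
    exact Complex.continuous_ofReal.comp (continuous_apply_apply i j)
  have hft : (t : ℂ) • B.map (algebraMap ℝ ℂ) = f (t • B) := by
    ext a b; simp [f]
  have hexp : f (NormedSpace.exp (t • B)) = NormedSpace.exp (f (t • B)) :=
    NormedSpace.map_exp f hf (t • B)
  rw [Function.comp_apply, hft, ← hexp]
  simp [f, Matrix.mulVec, dotProduct, ← Complex.ofReal_mul]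

theorem IsHurwitz.sub_smul_one {A : Matrix ι ι ℝ} (hA : IsHurwitz A) {s : ℝ} (hs : 0 ≤ s) :
    IsHurwitz (A - s • (1 : Matrix ι ι ℝ)) := by
  intro μ hμ
  have hmap : (A - s • (1 : Matrix ι ι ℝ)).map (algebraMap ℝ ℂ) =
      A.map (algebraMap ℝ ℂ) - algebraMap ℂ (Matrix ι ι ℂ) s := by
    ext i j
    by_cases hij : i = j
    · subst hij; simp [Matrix.algebraMap_matrix_apply]
    · simp [Matrix.algebraMap_matrix_apply, hij]
  rw [hmap] at hμ
  have h2 : μ + s ∈ spectrum ℂ (A.map (algebraMap ℝ ℂ)) := by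
    rw [spectrum.mem_iff] at hμ ⊢
    convert hμ using 2
    rw [map_add]; abel
  have := hA _ h2
  simp at this
  linarith

theorem IsHurwitz.isUnit {A : Matrix ι ι ℝ} (hA : IsHurwitz A) : IsUnit A := by
  have h0 : (0 : ℂ) ∉ spectrum ℂ (A.map (algebraMap ℝ ℂ)) := fun h => by
    simpa using hA 0 h
  rw [spectrum.zero_notMem_iff, Matrix.isUnit_iff_isUnit_det] at h0
  rw [Matrix.isUnit_iff_isUnit_det, isUnit_iff_ne_zero]
  intro hd
  have : (A.map (algebraMap ℝ ℂ)).det = algebraMap ℝ ℂ A.det :=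
    ((algebraMap ℝ ℂ).map_det A).symm
  rw [this, hd] at h0
  simp at h0

end Flow

/-! ### Eigenvectors of cone-preserving maps -/

section PerronFrobenius

variable {E : Type*} [NormedAddCommGroup E] [NormedSpace ℝ E] [FiniteDimensional ℝ E]

/-- The slice `φ = 1` of a closed cone on which `φ` dominates the norm is compact. -/
theorem isCompact_cone_slice {F : Set E} (hF : IsClosed F) (φ : E →L[ℝ] ℝ)
    (hφ : ∀ x ∈ F, ‖x‖ ≤ φ x) : IsCompact {x | x ∈ F ∧ φ x = 1} := by
  have : ProperSpace E := FiniteDimensional.proper ℝ E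
  refine (isCompact_closedBall (0 : E) 1).of_isClosed_subset
    (hF.inter (isClosed_eq φ.continuous continuous_const)) ?_
  rintro x ⟨hx, h1⟩
  simpa [h1] using hφ x hx

/-- Collatz-Wielandt: a linear map sending the nonzero elements of a pointed closed cone to order
units has an eigenvector in the cone. -/
theorem exists_eigenvector_of_strongly_positive {F : Set E} (hF : IsClosed F)
    (hsmul : ∀ r : ℝ, 0 ≤ r → ∀ x ∈ F, r • x ∈ F)
    (φ : E →L[ℝ] ℝ) (hφ : ∀ x ∈ F, ‖x‖ ≤ φ x) {e : E} (he : e ∈ F) (he0 : e ≠ 0)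
    (S : E →L[ℝ] E) (hS : ∀ x ∈ F, S x ∈ F)
    (hpos : ∀ x ∈ F, x ≠ 0 → ∀ z ∈ F, ∃ δ : ℝ, 0 < δ ∧ S x - δ • z ∈ F) :
    ∃ x ∈ F, φ x = 1 ∧ S x = φ (S x) • x := by
  have hφpos : ∀ x ∈ F, x ≠ 0 → 0 < φ x := fun x hx h0 =>
    (norm_pos_iff.mpr h0).trans_le (hφ x hx)
  have hnorm : ∀ x ∈ F, x ≠ 0 → (φ x)⁻¹ • x ∈ F ∧ φ ((φ x)⁻¹ • x) = 1 := fun x hx h0 =>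
    ⟨hsmul _ (inv_nonneg.mpr (hφpos x hx h0).le) _ hx, by
      rw [map_smul, smul_eq_mul, inv_mul_cancel₀ (hφpos x hx h0).ne']⟩
  have hφnn : ∀ x ∈ F, 0 ≤ φ x := fun x hx => (norm_nonneg x).trans (hφ x hx)
  have hK := isCompact_cone_slice hF φ hφ
  obtain ⟨m, hm⟩ := hK.bddAbove_image (f := fun x => φ (S x)) (by fun_prop)
  -- Normalized `x` with `ρ x ≤ S x` in the cone order. The set is compact, and a pair with maximal
  -- `ρ` is shown to be an eigenpair.
  let P : Set (ℝ × E) := (Set.Icc 0 m ×ˢ {x | x ∈ F ∧ φ x = 1}) ∩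
    {p | S p.2 - p.1 • p.2 ∈ F}
  have hP : IsCompact P := (isCompact_Icc.prod hK).inter_right (hF.preimage (by fun_prop))
  have hPmem : ∀ ρ x, 0 ≤ ρ → x ∈ F → φ x = 1 → S x - ρ • x ∈ F → (ρ, x) ∈ P := by
    intro ρ x hρ hx h1 h
    refine ⟨⟨⟨hρ, ?_⟩, hx, h1⟩, h⟩
    have h2 := hφnn _ h
    rw [map_sub, map_smul, h1, smul_eq_mul, mul_one] at h2
    have h3 : φ (S x) ≤ m := hm ⟨x, ⟨hx, h1⟩, rfl⟩
    simp only
    linarith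
  have hne : P.Nonempty := by
    obtain ⟨h1, h2⟩ := hnorm e he he0
    exact ⟨_, hPmem 0 _ le_rfl h1 h2 (by simpa using hS _ h1)⟩
  obtain ⟨⟨ρ, x⟩, ⟨⟨hρ, hx, hx1⟩, hxρ⟩, hmax⟩ :=
    hP.exists_isMaxOn hne (continuous_fst.continuousOn)
  simp only [Set.mem_ofPred_eq] at hxρ hx hx1
  have hzero : S x - ρ • x = 0 := by
    by_contra hy
    obtain ⟨δ, hδ, hδF⟩ := hpos _ hxρ hy _ (hS x hx)
    have hSx : S x ≠ 0 := by
      intro h0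
      have h1 := hφpos _ hxρ hy
      rw [h0, zero_sub, map_neg, map_smul, hx1, smul_eq_mul, mul_one] at h1
      have := hρ.1
      simp only at this
      linarith
    obtain ⟨h1, h2⟩ := hnorm _ (hS x hx) hSx
    have h3 := hPmem (ρ + δ) _ (add_nonneg hρ.1 hδ.le) h1 h2 (by
      have := hsmul _ (inv_nonneg.mpr (hφpos _ (hS x hx) hSx).le) _ hδF
      convert this using 1
      rw [map_smul, map_sub, map_smul]
      module)
    have := hmax h3
    simp only [Set.mem_ofPred_eq] at this
    linarith
  have hSx : S x = ρ • x := sub_eq_zero.mp hzero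
  refine ⟨x, hx, hx1, ?_⟩
  rw [hSx, map_smul, hx1, smul_eq_mul, mul_one]

/-- Krein-Rutman in finite dimension: a positive linear map on a pointed closed cone with an order
unit has an eigenvector in the cone. -/
theorem exists_eigenvector_of_positive {F : Set E} (hF : IsClosed F)
    (hadd : ∀ x ∈ F, ∀ y ∈ F, x + y ∈ F) (hsmul : ∀ r : ℝ, 0 ≤ r → ∀ x ∈ F, r • x ∈ F)
    (φ : E →L[ℝ] ℝ) (hφ : ∀ x ∈ F, ‖x‖ ≤ φ x) {e : E} (he : e ∈ F) (he0 : e ≠ 0)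
    (hunit : ∀ x ∈ F, ∃ α : ℝ, 0 < α ∧ α • e - x ∈ F)
    (R : E →L[ℝ] E) (hR : ∀ x ∈ F, R x ∈ F) :
    ∃ x ∈ F, φ x = 1 ∧ R x = φ (R x) • x := by
  have key : ∀ k : ℕ, ∃ x, (x ∈ F ∧ φ x = 1) ∧
      R x + (1 / ((k : ℝ) + 1)) • e =
        φ (R x + (1 / ((k : ℝ) + 1)) • e) • x := by
    intro k
    have hε : 0 < 1 / ((k : ℝ) + 1) := Nat.one_div_pos_of_nat
    set ε := 1 / ((k : ℝ) + 1)
    -- The rank-one perturbation is strongly positive because `e` is an order unit; compactness of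
    -- the slice lets `ε → 0` afterwards.
    let S : E →L[ℝ] E := R + φ.smulRight (ε • e)
    have hSx : ∀ x, S x = R x + φ x • ε • e := fun x => rfl
    obtain ⟨x, hx, h1, h⟩ := exists_eigenvector_of_strongly_positive hF hsmul φ hφ he he0 S
      (fun x hx => hadd _ (hR x hx) _
        (hsmul _ ((norm_nonneg x).trans (hφ x hx)) _ (hsmul _ hε.le _ he)))
      (fun x hx h0 z hz => by
        obtain ⟨α, hα, hαz⟩ := hunit z hz
        have hφx : 0 < φ x := (norm_pos_iff.mpr h0).trans_le (hφ x hx)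
        have hδ : 0 < φ x * ε / α := by positivity
        refine ⟨φ x * ε / α, hδ, ?_⟩
        have := hadd _ (hR x hx) _ (hsmul _ hδ.le _ hαz)
        convert this using 1
        rw [hSx, smul_sub, smul_smul, smul_smul, div_mul_cancel₀ _ hα.ne', add_sub_assoc])
    rw [hSx, h1, one_smul] at h
    exact ⟨x, ⟨hx, h1⟩, h⟩
  choose x hx h using key
  obtain ⟨y, hy, σ, hσ, hlim⟩ := (isCompact_cone_slice hF φ hφ).tendsto_subseq hx
  have h0 : Filter.Tendsto (fun k => (1 / ((σ k : ℝ) + 1)) • e) Filter.atTop (nhds 0) := by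
    have := (tendsto_one_div_add_atTop_nhds_zero_nat (𝕜 := ℝ)).comp hσ.tendsto_atTop
    simpa using this.smul_const e
  have h1 : Filter.Tendsto (fun k => R (x (σ k)) + (1 / ((σ k : ℝ) + 1)) • e) Filter.atTop
      (nhds (R y)) := by
    simpa using ((R.continuous.tendsto y).comp hlim).add h0
  have h2 := ((φ.continuous.tendsto _).comp h1).smul hlim
  refine ⟨y, hy.1, hy.2, tendsto_nhds_unique h1 (h2.congr fun k => ?_)⟩
  exact (h (σ k)).symm

end PerronFrobenius

/-! ### The resolvent as an integrated flow, and the Rosenbrock rank -/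

section Resolvent

variable {ι : Type*} [Fintype ι] [DecidableEq ι]

/-- If `B` is Hurwitz and `ℓ` is nonnegative along the flow of `B` from `y`, then `ℓ` is nonnegative
and bounded by its initial value along the flow from `w = (-B)⁻¹ y`. -/
theorem IsHurwitz.flow_resolvent_bounds {B : Matrix ι ι ℝ} (hB : IsHurwitz B) {y w : ι → ℝ}
    (hw : B *ᵥ w = -y) (ℓ : (ι → ℝ) →L[ℝ] ℝ)
    (h : ∀ t : ℝ, 0 ≤ t → 0 ≤ ℓ (NormedSpace.exp (t • B) *ᵥ y)) (t : ℝ) (ht : 0 ≤ t) :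
    0 ≤ ℓ (NormedSpace.exp (t • B) *ᵥ w) ∧ ℓ (NormedSpace.exp (t • B) *ᵥ w) ≤ ℓ w := by
  have hd : ∀ s : ℝ, HasDerivAt (fun s : ℝ => ℓ (NormedSpace.exp (s • B) *ᵥ w))
      (-ℓ (NormedSpace.exp (s • B) *ᵥ y)) s := fun s => by
    have := ℓ.hasFDerivAt.comp_hasDerivAt s (hasDerivAt_exp_mulVec B w s)
    rwa [hw, Matrix.mulVec_neg, map_neg] at this
  have hanti : AntitoneOn (fun s : ℝ => ℓ (NormedSpace.exp (s • B) *ᵥ w)) (Set.Ici 0) := by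
    refine antitoneOn_of_deriv_nonpos (convex_Ici 0)
      (fun s _ => (hd s).continuousAt.continuousWithinAt)
      (fun s _ => (hd s).differentiableAt.differentiableWithinAt) fun s hs => ?_
    rw [interior_Ici, Set.mem_Ioi] at hs
    rw [(hd s).deriv]
    linarith [h s hs.le]
  constructor
  -- A nonincreasing function tending to `0` is nonnegative; this stands in for the integral formula
  -- for `(-B)⁻¹`.
  · have hlim := (ℓ.continuous.tendsto _).comp (hB.tendsto_exp_mulVec w)
    rw [map_zero] at hlim
    refine le_of_tendsto hlim ?_
    filter_upwards [Filter.eventually_ge_atTop t] with s hs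
    exact hanti ht (ht.trans hs) hs
  · simpa using hanti Set.self_mem_Ici ht ht

/-- A functional vanishing along the flow from `y` vanishes at `(-B)⁻¹ y`. -/
theorem IsHurwitz.resolvent_eq_zero {B : Matrix ι ι ℝ} (hB : IsHurwitz B) {y w : ι → ℝ}
    (hw : B *ᵥ w = -y) (ℓ : (ι → ℝ) →L[ℝ] ℝ)
    (h : ∀ t : ℝ, 0 ≤ t → ℓ (NormedSpace.exp (t • B) *ᵥ y) = 0) : ℓ w = 0 := by
  have h1 := (hB.flow_resolvent_bounds hw ℓ (fun t ht => (h t ht).ge) 0 le_rfl).1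
  have h2 := (hB.flow_resolvent_bounds hw (-ℓ) (fun t ht => by simp [h t ht]) 0 le_rfl).1
  simp only [zero_smul, NormedSpace.exp_zero, Matrix.one_mulVec, neg_apply] at h1 h2
  simp at h2
  linarith

/-- With zero input, cone invariance of the system makes the flow of every shift `A - s` preserve
the cone. -/
theorem IsConeInvariantSystem.exp_shift_mulVec_mem {K : Set (ι → ℝ)} {A : Matrix ι ι ℝ}
    {b c : ι → ℝ} (h : IsConeInvariantSystem K A b c)
    (hsmul : ∀ r : ℝ, 0 ≤ r → ∀ x ∈ K, r • x ∈ K) (s : ℝ) {x : ι → ℝ} (hx : x ∈ K) {t : ℝ}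
    (ht : 0 ≤ t) :
    NormedSpace.exp (t • (A - s • (1 : Matrix ι ι ℝ))) *ᵥ x ∈ K := by
  set B := A - s • (1 : Matrix ι ι ℝ) with hB
  -- The scalar factor undoes the shift, turning the flow of `B` into that of `A`.
  have htraj : IsTrajectory A b (fun _ => 0)
      (fun t => Real.exp (s * t) • (NormedSpace.exp (t • B) *ᵥ x)) := by
    intro τ _
    have h1 : HasDerivAt (fun t => Real.exp (s * t)) (Real.exp (s * τ) * s) τ := by
      simpa using ((hasDerivAt_id τ).const_mul s).exp
    have h2 := h1.smul (hasDerivAt_exp_mulVec B x τ)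
    refine (h2.congr_deriv ?_).hasDerivWithinAt
    have hA : A = B + s • (1 : Matrix ι ι ℝ) := by rw [hB, sub_add_cancel]
    rw [exp_mulVec_comm, hA, Matrix.add_mulVec, Matrix.smul_mulVec, Matrix.one_mulVec,
      Matrix.mulVec_smul]
    module
  have h0 := (h (fun _ => 0) _ continuousOn_const (fun _ _ => le_rfl) htraj
    (by simpa using hx) t ht).1
  have := hsmul (Real.exp (s * t))⁻¹ (by positivity) _ h0
  rwa [smul_smul, inv_mul_cancel₀ (Real.exp_pos _).ne', one_smul] at this

theorem rank_rosenbrock_eq {A : Matrix ι ι ℝ} {b c : ι → ℝ} {s : ℝ}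
    (hA : IsUnit (A - s • (1 : Matrix ι ι ℝ)))
    (h : ∀ z, (A - s • (1 : Matrix ι ι ℝ)) *ᵥ z = -b → c ⬝ᵥ z ≠ 0) :
    (rosenbrock A b c s).rank = Fintype.card ι + 1 := by
  have hinj := Matrix.mulVec_injective_iff_isUnit.mpr hA
  obtain ⟨z, hz⟩ := Matrix.mulVec_surjective_iff_isUnit.mpr hA (-b)
  have hu : IsUnit (rosenbrock A b c s) := by
    rw [← Matrix.mulVec_injective_iff_isUnit]
    refine (injective_iff_map_eq_zero (Matrix.mulVecLin (rosenbrock A b c s))).mpr fun w hw => ?_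
    obtain ⟨x, u, rfl⟩ : ∃ x u, w = Sum.elim x u := ⟨_, _, (Sum.elim_comp_inl_inr w).symm⟩
    rw [Matrix.mulVecLin_apply, rosenbrock, Matrix.fromBlocks_mulVec] at hw
    simp only [Sum.elim_comp_inl, Sum.elim_comp_inr] at hw
    have h1 : (s • (1 : Matrix ι ι ℝ) - A) *ᵥ x + u () • b = 0 := by
      funext i
      simpa [Matrix.mulVec, dotProduct, mul_comm] using congrFun hw (Sum.inl i)
    have h2 : c ⬝ᵥ x = 0 := by
      simpa [Matrix.mulVec, dotProduct] using congrFun hw (Sum.inr ())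
    -- The state rows of the kernel equation read `B x = u b`; the output row then becomes `u (c ⬝ᵥ
    -- z) = 0`.
    have hx : x = -u () • z := by
      apply hinj
      rw [Matrix.mulVec_smul, hz]
      rw [← neg_sub, Matrix.neg_mulVec] at h1
      have := eq_neg_of_add_eq_zero_right h1
      rw [neg_neg] at this
      rw [← this]; simp
    have hu0 : u () = 0 := by
      rw [hx, dotProduct_smul, smul_eq_mul] at h2
      simpa [h z hz] using h2
    rw [hu0] at hx
    funext k
    rcases k with i | i
    · simp [hx]
    · exact hu0
  rw [Matrix.rank_of_isUnit _ hu, Fintype.card_sum, Fintype.card_unit]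

end Resolvent

/-! ### The positive semidefinite cone, its faces and its basis vectors -/

section PSDCone

variable {n : ℕ}

/-- The quadratic form `v ↦ vᵀ X v` as a linear functional of the vectorized matrix `X`. -/
noncomputable def quadForm (v : Fin n → ℝ) : (UpperIdx n → ℝ) →L[ℝ] ℝ :=
  LinearMap.toContinuousLinearMap
    { toFun := fun x => v ⬝ᵥ (symMat x *ᵥ v)
      map_add' := fun x y => by
        have : symMat (x + y) = symMat x + symMat y := rfl
        rw [this, Matrix.add_mulVec, dotProduct_add]
      map_smul' := fun r x => by
        have : symMat (r • x) = r • symMat x := rfl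
        rw [this, Matrix.smul_mulVec, dotProduct_smul, RingHom.id_apply] }

theorem quadForm_apply (v : Fin n → ℝ) (x : UpperIdx n → ℝ) :
    quadForm v x = v ⬝ᵥ (symMat x *ᵥ v) := rfl

theorem symMat_isSymm (x : UpperIdx n → ℝ) : (symMat x).IsSymm := by
  ext i j
  simp [symMat, min_comm, max_comm]

theorem mem_psdCone_iff {x : UpperIdx n → ℝ} : x ∈ psdCone n ↔ ∀ v, 0 ≤ quadForm v x := by
  rw [psdCone, Set.mem_ofPred_eq, Matrix.posSemidef_iff_dotProduct_mulVec]
  refine and_iff_right ?_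
  rw [Matrix.IsHermitian, Matrix.conjTranspose_eq_transpose_of_trivial]
  exact symMat_isSymm x

theorem psdCone_smul_mem {r : ℝ} (hr : 0 ≤ r) {x : UpperIdx n → ℝ} (hx : x ∈ psdCone n) :
    r • x ∈ psdCone n := by
  rw [mem_psdCone_iff] at hx ⊢
  intro v
  rw [map_smul]
  exact mul_nonneg hr (hx v)

theorem quadForm_single_add_smul_single (x : UpperIdx n → ℝ) (i j : Fin n) (r : ℝ) :
    quadForm (Pi.single i 1 + r • Pi.single j 1) x =
      symMat x i i + 2 * r * symMat x i j + r ^ 2 * symMat x j j := by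
  have h := (symMat_isSymm x).apply i j
  simp only [quadForm_apply, Matrix.mulVec_add, Matrix.mulVec_smul, add_dotProduct,
    dotProduct_add, smul_dotProduct, dotProduct_smul, Matrix.mulVec_single_one,
    single_one_dotProduct, Matrix.col_apply, smul_eq_mul, h]
  ring

theorem quadForm_single (x : UpperIdx n → ℝ) (i : Fin n) :
    quadForm (Pi.single i 1) x = x ⟨(i, i), le_rfl⟩ := by
  simp [quadForm_apply, symMat]

/-- The trace of a vectorized matrix. -/
noncomputable def vecTrace : (UpperIdx n → ℝ) →L[ℝ] ℝ :=
  ∑ i : Fin n, quadForm (Pi.single i 1)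

theorem vecTrace_apply (x : UpperIdx n → ℝ) : vecTrace x = ∑ i, x ⟨(i, i), le_rfl⟩ := by
  simp [vecTrace, quadForm_single]

/-- Testing on `e_i ± e_j` gives `2 |x i j| ≤ x i i + x j j`. This makes the trace the normalizing
functional for Krein-Rutman and also excludes off-diagonal basis vectors from the cone. -/
theorem norm_le_vecTrace {x : UpperIdx n → ℝ} (hx : x ∈ psdCone n) : ‖x‖ ≤ vecTrace x := by
  rw [mem_psdCone_iff] at hx
  have hd : ∀ i, 0 ≤ x ⟨(i, i), le_rfl⟩ := fun i =>
    quadForm_single x i ▸ hx (Pi.single i 1)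
  have hle : ∀ i, x ⟨(i, i), le_rfl⟩ ≤ vecTrace x := fun i => by
    rw [vecTrace_apply]
    exact Finset.single_le_sum (f := fun i => x ⟨(i, i), le_rfl⟩) (fun j _ => hd j)
      (Finset.mem_univ i)
  refine (pi_norm_le_iff_of_nonneg ?_).mpr ?_
  · rw [vecTrace_apply]
    exact Finset.sum_nonneg fun i _ => hd i
  · rintro ⟨⟨i, j⟩, hij⟩
    have h1 := hx (Pi.single i 1 + (1 : ℝ) • Pi.single j 1)
    have h2 := hx (Pi.single i 1 + (-1 : ℝ) • Pi.single j 1)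
    rw [quadForm_single_add_smul_single] at h1 h2
    have hs : symMat x i j = x ⟨(i, j), hij⟩ := congrFun (halfVec_symMat x) ⟨(i, j), hij⟩
    have hi : symMat x i i = x ⟨(i, i), le_rfl⟩ := by simp [symMat]
    have hj : symMat x j j = x ⟨(j, j), le_rfl⟩ := by simp [symMat]
    rw [hs, hi, hj] at h1 h2
    rw [Real.norm_eq_abs, abs_le]
    constructor <;> linarith [hle i, hle j]

theorem isClosed_psdCone : IsClosed (psdCone n) := by
  have : psdCone n = ⋂ v, {x | 0 ≤ quadForm v x} := by
    ext x; simp [mem_psdCone_iff]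
  rw [this]
  exact isClosed_iInter fun v => isClosed_le continuous_const (quadForm v).continuous

theorem vecDiag_eq_single (i : Fin n) : vecDiag i = Pi.single ⟨(i, i), le_rfl⟩ 1 := by
  funext ⟨⟨j, k⟩, hjk⟩
  by_cases hj : j = i <;> by_cases hk : j = k <;>
    simp_all [vecDiag, halfVec, eq_comm]

theorem symMat_vecDiag (i : Fin n) :
    symMat (vecDiag i) = Matrix.diagonal (Pi.single i (1 : ℝ)) :=
  symMat_halfVec _ (Matrix.isSymm_diagonal _)

theorem vecDiag_mem_psdCone (i : Fin n) : vecDiag i ∈ psdCone n := by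
  rw [psdCone, Set.mem_ofPred_eq, symMat_vecDiag]
  exact Matrix.PosSemidef.diagonal (Pi.single_nonneg.mpr zero_le_one)

theorem traceInner_comm (x y : UpperIdx n → ℝ) : traceInner x y = traceInner y x :=
  Matrix.trace_mul_comm _ _

theorem traceInner_vecDiag (i : Fin n) (x : UpperIdx n → ℝ) :
    traceInner (vecDiag i) x = quadForm (Pi.single i 1) x := by
  rw [traceInner, symMat_vecDiag, quadForm_single]
  simp [Matrix.trace, Matrix.diagonal_mul, Pi.single_apply, symMat]

theorem traceInner_halfVec_vecMulVec (v : Fin n → ℝ) (x : UpperIdx n → ℝ) :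
    traceInner x (halfVec (Matrix.vecMulVec v v)) = quadForm v x := by
  rw [traceInner, symMat_halfVec _ (by rw [Matrix.IsSymm, Matrix.transpose_vecMulVec]),
    Matrix.mul_vecMulVec, Matrix.trace_vecMulVec, quadForm_apply, dotProduct_comm]

/-- Pairing with the rank-one matrix `v vᵀ`, which is in the cone, evaluates the quadratic form at
`v`. -/
theorem dualCone_psdCone_subset : dualCone traceInner (psdCone n) ⊆ psdCone n := by
  intro y hy
  rw [mem_psdCone_iff]
  intro v
  rw [← traceInner_halfVec_vecMulVec, traceInner_comm]
  refine hy _ ?_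
  rw [psdCone, Set.mem_ofPred_eq,
    symMat_halfVec _ (by rw [Matrix.IsSymm, Matrix.transpose_vecMulVec])]
  simpa using Matrix.posSemidef_vecMulVec_self_star v

theorem vecDiag_mem_dualCone (i : Fin n) : vecDiag i ∈ dualCone traceInner (psdCone n) := by
  intro x hx
  rw [traceInner_comm, traceInner_vecDiag]
  exact mem_psdCone_iff.mp hx _

theorem basisIn_psdCone_subset : basisIn (psdCone n) ⊆ Set.range (vecDiag (n := n)) := by
  rintro _ ⟨hv, ⟨⟨i, j⟩, hij⟩, rfl⟩
  rcases eq_or_ne i j with rfl | hne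
  · exact ⟨i, vecDiag_eq_single i⟩
  · exfalso
    have h := norm_le_vecTrace hv
    have h0 : vecTrace (Pi.single (⟨(i, j), hij⟩ : UpperIdx n) (1 : ℝ)) = 0 := by
      rw [vecTrace_apply]
      refine Finset.sum_eq_zero fun k _ => Pi.single_eq_of_ne ?_ _
      intro hk
      simp only [Subtype.mk.injEq, Prod.mk.injEq] at hk
      exact hne (hk.1.symm.trans hk.2)
    rw [h0, Pi.norm_single, norm_one] at h
    linarith

theorem attackSet_eq : attackSet n = Set.range (vecDiag (n := n)) := by
  refine Set.Subset.antisymm basisIn_psdCone_subset ?_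
  rintro _ ⟨i, rfl⟩
  exact ⟨vecDiag_mem_psdCone i, _, vecDiag_eq_single i⟩

theorem sensorSet_eq : sensorSet n = Set.range (vecDiag (n := n)) := by
  refine Set.Subset.antisymm
    (fun v hv => basisIn_psdCone_subset ⟨dualCone_psdCone_subset hv.1, hv.2⟩) ?_
  rintro _ ⟨i, rfl⟩
  exact ⟨vecDiag_mem_dualCone i, _, vecDiag_eq_single i⟩

/-- Subtracting any positive multiple of `diag (e_i)` makes the `i`-th diagonal entry negative, so
`x` is not interior. -/
theorem mem_frontier_psdCone {x : UpperIdx n → ℝ} (hx : x ∈ psdCone n) (i : Fin n)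
    (h : quadForm (Pi.single i 1) x = 0) : x ∈ frontier (psdCone n) := by
  refine ⟨subset_closure hx, fun hint => ?_⟩
  have hc : Continuous fun t : ℝ => x - t • vecDiag i := by fun_prop
  have h1 : ∀ᶠ t : ℝ in nhds 0, x - t • vecDiag i ∈ psdCone n := by
    refine hc.continuousAt.eventually_mem (mem_interior_iff_mem_nhds.mp ?_)
    simpa using hint
  obtain ⟨t, ht, ht0⟩ := ((h1.filter_mono nhdsWithin_le_nhds).and
    (self_mem_nhdsWithin (s := Set.Ioi (0 : ℝ)))).exists
  have h2 := mem_psdCone_iff.mp ht (Pi.single i 1)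
  rw [map_sub, map_smul, h, quadForm_single, vecDiag_eq_single, Pi.single_eq_same] at h2
  have ht0' : 0 < t := ht0
  simp at h2
  linarith

open scoped MatrixOrder in
/-- A positive semidefinite matrix whose form vanishes wherever that of `z` does is dominated by a
multiple of `z`. -/
theorem exists_smul_sub_mem_psdCone {x z : UpperIdx n → ℝ} (hx : x ∈ psdCone n)
    (hz : z ∈ psdCone n) (h : ∀ v, quadForm v z = 0 → quadForm v x = 0) :
    ∃ α : ℝ, 0 < α ∧ α • z - x ∈ psdCone n := by
  have hsq : ∀ y ∈ psdCone n, ∃ C : Matrix (Fin n) (Fin n) ℝ,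
      ∀ v, quadForm v y = ‖WithLp.toLp 2 (C *ᵥ v)‖ ^ 2 := by
    intro y hy
    obtain ⟨C, hC⟩ := CStarAlgebra.nonneg_iff_eq_star_mul_self.mp (Matrix.PosSemidef.nonneg hy)
    refine ⟨C, fun v => ?_⟩
    rw [quadForm_apply, hC, ← Matrix.mulVec_mulVec, Matrix.dotProduct_mulVec,
      Matrix.star_eq_conjTranspose, Matrix.conjTranspose_eq_transpose_of_trivial,
      Matrix.vecMul_transpose, EuclideanSpace.norm_sq_eq]
    simp [dotProduct, sq]
  obtain ⟨C, hC⟩ := hsq z hz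
  obtain ⟨D, hD⟩ := hsq x hx
  let e := (WithLp.linearEquiv 2 ℝ (Fin n → ℝ)).symm
  let c : (Fin n → ℝ) →ₗ[ℝ] EuclideanSpace ℝ (Fin n) := e.toLinearMap ∘ₗ C.mulVecLin
  let d : (Fin n → ℝ) →ₗ[ℝ] EuclideanSpace ℝ (Fin n) := e.toLinearMap ∘ₗ D.mulVecLin
  have hc : ∀ v, quadForm v z = ‖c v‖ ^ 2 := hC
  have hd : ∀ v, quadForm v x = ‖d v‖ ^ 2 := hD
  -- With `z = CᵀC` and `x = DᵀD`, the hypothesis says `ker C ≤ ker D`, so `D` factors through `C`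
  -- by a map `g`, and `‖g‖²` bounds the ratio of the forms.
  have hker : LinearMap.ker c ≤ LinearMap.ker d := fun v hv => by
    have h1 : quadForm v z = 0 := by rw [hc, LinearMap.mem_ker.mp hv]; simp
    have h2 := h v h1
    rw [hd] at h2
    simpa using h2
  obtain ⟨g, hg⟩ := LinearMap.exists_extend
    ((LinearMap.ker c).liftQ d hker ∘ₗ c.quotKerEquivRange.symm.toLinearMap)
  have hgc : ∀ v, g (c v) = d v := fun v => by
    have h1 := LinearMap.congr_fun hg ⟨c v, v, rfl⟩
    have h2 := c.quotKerEquivRange_symm_apply_image v ⟨v, rfl⟩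
    simp only [LinearMap.comp_apply, LinearEquiv.coe_coe, h2] at h1
    exact h1
  let G := LinearMap.toContinuousLinearMap g
  -- The `+ 1` only secures strict positivity.
  refine ⟨‖G‖ ^ 2 + 1, by positivity, mem_psdCone_iff.mpr fun v => ?_⟩
  have hdv : ‖d v‖ ≤ ‖G‖ * ‖c v‖ := by
    rw [← hgc]; exact G.le_opNorm (c v)
  have := pow_le_pow_left₀ (norm_nonneg _) hdv 2
  rw [map_sub, map_smul, smul_eq_mul, hc, hd]
  nlinarith [sq_nonneg ‖c v‖]

/-- For a Hurwitz matrix whose flow preserves the cone and which has no eigenvector on its boundary,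
the resolvent maps nonzero positive semidefinite matrices to matrices with positive diagonal. -/
theorem quadForm_resolvent_ne_zero {B : Matrix (UpperIdx n) (UpperIdx n) ℝ} (hB : IsHurwitz B)
    (hflow : ∀ x ∈ psdCone n, ∀ t : ℝ, 0 ≤ t → NormedSpace.exp (t • B) *ᵥ x ∈ psdCone n)
    (hirr : IsConeIrreducible (psdCone n) B) {y z : UpperIdx n → ℝ} (hy : y ∈ psdCone n)
    (hy0 : y ≠ 0) (hz : B *ᵥ z = -y) (i : Fin n) : quadForm (Pi.single i 1) z ≠ 0 := by
  intro hi
  have hres : ∀ x ∈ psdCone n, ∀ w, B *ᵥ w = -x → ∀ v, ∀ t : ℝ, 0 ≤ t →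
      0 ≤ quadForm v (NormedSpace.exp (t • B) *ᵥ w) ∧
        quadForm v (NormedSpace.exp (t • B) *ᵥ w) ≤ quadForm v w :=
    fun x hx w hw v => hB.flow_resolvent_bounds hw (quadForm v)
      fun t ht => mem_psdCone_iff.mp (hflow x hx t ht) v
  have hresK : ∀ x ∈ psdCone n, ∀ w, B *ᵥ w = -x → w ∈ psdCone n := fun x hx w hw =>
    mem_psdCone_iff.mpr fun v => by simpa using (hres x hx w hw v 0 le_rfl).1
  have hzK := hresK y hy z hz
  have hz0 : z ≠ 0 := by
    rintro rfl
    rw [Matrix.mulVec_zero] at hz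
    exact hy0 (neg_eq_zero.mp hz.symm)
  -- The face generated by `z`; by the domination lemma, `z` is an order unit of it.
  let F : Set (UpperIdx n → ℝ) :=
    {x | x ∈ psdCone n ∧ ∀ v, quadForm v z = 0 → quadForm v x = 0}
  have hFclosed : IsClosed F := by
    have : F = psdCone n ∩ ⋂ v, ⋂ (_ : quadForm v z = 0), {x | quadForm v x = 0} := by
      ext x; simp [F]
    rw [this]
    exact isClosed_psdCone.inter (isClosed_iInter fun v => isClosed_iInter fun _ =>
      isClosed_eq (quadForm v).continuous continuous_const)
  have hflowF : ∀ x ∈ F, ∀ v, quadForm v z = 0 → ∀ t : ℝ, 0 ≤ t →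
      quadForm v (NormedSpace.exp (t • B) *ᵥ x) = 0 := by
    intro x hx v hv t ht
    -- At `v`, the form of `exp(tB) x` lies between `0` and `α` times that of `exp(tB) z`, which is
    -- at most that of `z`, namely `0`.
    obtain ⟨α, hα, hαK⟩ := exists_smul_sub_mem_psdCone hx.1 hzK hx.2
    have h1 := mem_psdCone_iff.mp (hflow _ hαK t ht) v
    have h2 := mem_psdCone_iff.mp (hflow _ hx.1 t ht) v
    have h3 := (hres y hy z hz v t ht).2
    rw [Matrix.mulVec_sub, Matrix.mulVec_smul, map_sub, map_smul, smul_eq_mul] at h1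
    rw [hv] at h3
    nlinarith [mul_le_mul_of_nonneg_left h3 hα.le]
  let R : (UpperIdx n → ℝ) →L[ℝ] (UpperIdx n → ℝ) :=
    LinearMap.toContinuousLinearMap (-B⁻¹).mulVecLin
  have hR : ∀ x, B *ᵥ R x = -x := by
    intro x
    change B *ᵥ ((-B⁻¹) *ᵥ x) = -x
    rw [Matrix.mulVec_mulVec, Matrix.mul_neg,
      Matrix.mul_nonsing_inv _ ((Matrix.isUnit_iff_isUnit_det _).mp hB.isUnit),
      Matrix.neg_mulVec, Matrix.one_mulVec]
  obtain ⟨x, hx, hx1, hρ⟩ := exists_eigenvector_of_positive hFclosed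
    (fun x hx w hw => ⟨mem_psdCone_iff.mpr fun v => by
        rw [map_add]
        exact add_nonneg (mem_psdCone_iff.mp hx.1 v) (mem_psdCone_iff.mp hw.1 v),
      fun v hv => by rw [map_add, hx.2 v hv, hw.2 v hv, add_zero]⟩)
    (fun r hr x hx => ⟨psdCone_smul_mem hr hx.1,
      fun v hv => by rw [map_smul, hx.2 v hv, smul_zero]⟩)
    vecTrace (fun x hx => norm_le_vecTrace hx.1) (e := z) ⟨hzK, fun _ h => h⟩ hz0
    (fun x hx => by
      obtain ⟨α, hα, hαK⟩ := exists_smul_sub_mem_psdCone hx.1 hzK hx.2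
      exact ⟨α, hα, hαK, fun v hv => by
        rw [map_sub, map_smul, hv, hx.2 v hv, smul_zero, sub_zero]⟩)
    R (fun x hx => ⟨hresK x hx.1 _ (hR x), fun v hv =>
      hB.resolvent_eq_zero (hR x) (quadForm v) (hflowF x hx v hv)⟩)
  set ρ := vecTrace (R x)
  have hx0 : x ≠ 0 := by rintro rfl; simp at hx1
  have hBx : ρ • B *ᵥ x = -x := by rw [← Matrix.mulVec_smul, ← hρ, hR]
  have hρ0 : ρ ≠ 0 := by
    intro h0
    rw [h0, zero_smul] at hBx
    exact hx0 (neg_eq_zero.mp hBx.symm)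
  -- An eigenvalue `ρ` of `(-B)⁻¹` is the eigenvalue `-ρ⁻¹` of `B`; membership in `F` makes the
  -- `i`-th diagonal entry of `x` vanish.
  refine hirr (-ρ⁻¹) x ⟨?_, hx0⟩ (mem_frontier_psdCone hx.1 i (hx.2 _ hi))
  rw [Module.End.mem_eigenspace_iff, Matrix.toLin'_apply, neg_smul, ← smul_neg, ← hBx,
    smul_smul, inv_mul_cancel₀ hρ0, one_smul]

theorem IsConeIrreducible.sub_smul_one {ι : Type*} [Fintype ι] [DecidableEq ι]
    {K : Set (ι → ℝ)} {A : Matrix ι ι ℝ} (hA : IsConeIrreducible K A) (s : ℝ) :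
    IsConeIrreducible K (A - s • (1 : Matrix ι ι ℝ)) := by
  rintro μ x ⟨hx, hx0⟩
  refine hA (μ + s) x ⟨?_, hx0⟩
  rw [Module.End.mem_eigenspace_iff, Matrix.toLin'_apply] at hx ⊢
  rw [Matrix.sub_mulVec, Matrix.smul_mulVec, Matrix.one_mulVec] at hx
  rw [add_smul, ← hx, sub_add_cancel]

end PSDCone

end ConeDefense

theorem mainTheorem10 (n : ℕ)
    (A : Matrix (ConeDefense.UpperIdx n) (ConeDefense.UpperIdx n) ℝ)
    (hstable : ConeDefense.IsHurwitz A)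
    (hcross : ConeDefense.IsCrossPositive ConeDefense.traceInner (ConeDefense.psdCone n) A)
    (hirr : ConeDefense.IsConeIrreducible (ConeDefense.psdCone n) A) :
    ConeDefense.attackSet n = Set.range (ConeDefense.vecDiag (n := n)) ∧
    ConeDefense.sensorSet n = ConeDefense.attackSet n ∧
    ∀ b ∈ ConeDefense.attackSet n, ∀ c ∈ ConeDefense.sensorSet n,
      ConeDefense.IsConeInvariantSystem (ConeDefense.psdCone n) A b c →
      ConeDefense.IsSuccessfulDefense A b c := by
  refine ⟨ConeDefense.attackSet_eq,
    ConeDefense.sensorSet_eq.trans ConeDefense.attackSet_eq.symm, ?_⟩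
  intro b hb c hc hinv s hs
  have hB := hstable.sub_smul_one hs
  -- The full-rank alternative holds for every `s ≥ 0`.
  refine Or.inl (ConeDefense.rank_rosenbrock_eq hB.isUnit fun z hz => ?_)
  rw [ConeDefense.sensorSet_eq] at hc
  obtain ⟨i, rfl⟩ := hc
  obtain ⟨hbK, p, rfl⟩ := hb
  have := ConeDefense.quadForm_resolvent_ne_zero hB
    (fun x hx t ht => hinv.exp_shift_mulVec_mem
      (fun r hr x hx => ConeDefense.psdCone_smul_mem hr hx) s hx ht)
    (hirr.sub_smul_one s) hbK (by simp) hz i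
  rwa [ConeDefense.vecDiag_eq_single, single_one_dotProduct, ← ConeDefense.quadForm_single z i]
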